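/- Let $S=\mathbb{R}^2/\mathbb{Z}^2$ be the torus with one puncture (marked point) $p$. An \emph{arc} is the homotopy class (relative to the endpoints, and up to reversal of direction) of a non-contractible curve in $S$ that starts and ends at $p$ and otherwise meets neither $p$ nor itself. The intersection number of two different arcs is the least number of points of $S\setminus\{p\}$ in which representatives of them meet; the intersection number of an arc with itself is $0$. A \emph{triangulation} is an ordered triple $M=(m_1,m_2,m_3)$ of arcs that form a maximal collection of distinct arcs which pairwise have representatives meeting only at $p$. A \emph{flip in direction $k$} exchanges $m_k$ for a different arc so that a triangulation results. For an arc $\ell$, the \emph{intersection vector} $D(M,\ell)\in\mathbb{Z}_{\ge 0}^3$ has as its $i$-th entry the intersection number of $\ell$ and $m_i$. Let $\mathbb{T}_3$ be the $3$-regular tree with edges labelled $1,2,3$ such that the three edges at each vertex have different labels, let $t_0$ be a vertex of it, let $t_1$ be the vertex joined to $t_0$ by the edge labelled $3$, and let $\mathbb{T}_3'$ be the full subtree of all vertices that can be reached from $t_1$ without going through $t_0$, with root $t_1$. Let $L=(\ell_1,\ell_2,\ell_3)$ be any triangulation. (1) There is exactly one assignment $t\mapsto L_t$ of triangulations to the vertices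 of $\mathbb{T}_3$ (the \emph{cluster pattern} of $L$) such that $L_{t_0}=L$ and, whenever $t,t'$ are joined by an edge labelled $k$, the triangulations $L_t$ and $L_{t'}$ are obtained from each other by a flip in direction $k$. The \emph{initial intersection vector tree} is the tree $\mathbb{T}_3'$ with the vector $D(L_t,\ell_3)=(d_{1;t},d_{2;t},d_{3;t})^{T}$ standing at each vertex $t$. (2) There is exactly one well-defined map $h\colon\{D(L_t,\ell_3)\}_{t\in\mathbb{T}_3'}\to\mathbb{Q}$ given inductively as follows. It maps $$D(L_{t_1},\ell_3)\mapsto\frac{d_{1;t_1}+1}{d_{2;t_1}+1}=\frac11 .$$ If $\{a,b,c\}=\{1,2,3\}$, $D(L_t,\ell_3)$ has been mapped to $\dfrac{d_{a;t}+1}{d_{b;t}+1}$, and $t,t'$ are joined by an edge labelled $k$ with $t'$ farther from $t_1$ than $t$, then $$D(L_{t'},\ell_3)\mapsto\frac{d_{c;t}+1}{d_{b;t}+1}\ \text{ if } k=a,\qquad D(L_{t'},\ell_3)\mapsto\frac{d_{a;t}+1}{d_{c;t}+1}\ \text{ if } k=b,$$ the index pair being $(c,b)$, respectively $(a,c)$,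 at $t'$. (3) Replacing each vertex $v$ of the initial intersection vector tree by $h(v)$ gives exactly the Calkin--Wilf tree, with its root and its edge labels; moreover, if $(a,b)$ is the index pair at $t$, then $d_{a;t}+1$ and $d_{b;t}+1$ are the numerator and the denominator of the corresponding fraction of the Calkin--Wilf tree. Here the Calkin--Wilf tree is the full binary tree of fractions with root $\frac11$ in which $\frac xy$ has the left child $\frac{x}{x+y}$ and the right child $\frac{x+y}{y}$. Its edges are labelled as follows: the edge from $\frac11$ to $\frac21$ has the label $1$ and the edge from $\frac11$ to $\frac12$ the label $2$; if the edges from a vertex to its left and right child have the labels $a$ and $b$, and $\{a,b,c\}=\{1,2,3\}$, then the edges from the left child to its left and right child have the labels $c$ and $b$, and those from the right child have the labels $a$ and $c$. -/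

import Mathlib

namespace PuncturedTorus

/-! Labels and positions `1, 2, 3` are written `0, 1, 2 : Fin 3` throughout. -/

/-! ### Arcs on the one-punctured torus -/

/-- The torus `ℝ² / ℤ²`. -/
abbrev Torus : Type := AddCircle (1 : ℝ) × AddCircle (1 : ℝ)

/-- The puncture `p`. -/
def puncture : Torus := (0, 0)

/-- A curve representing an arc: both endpoints are the puncture, it meets neither itself nor
the puncture apart from its endpoints, and it cannot be contracted to the puncture. -/
structure ArcCurve where
  path : Path puncture puncture
  simple : ∀ s t : unitInterval, path s = path t → s = t ∨ (s = 0 ∧ t = 1) ∨ (s = 1 ∧ t = 0)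
  essential : ¬ path.Homotopic (Path.refl puncture)

/-- Homotopy with fixed endpoints, up to reversal: arcs carry no orientation. -/
instance arcSetoid : Setoid ArcCurve where
  r γ δ := γ.path.Homotopic δ.path ∨ γ.path.Homotopic δ.path.symm
  iseqv :=
    { refl := fun γ => Or.inl (Path.Homotopic.refl γ.path)
      symm := by
        rintro γ δ (h | h)
        · exact Or.inl h.symm
        · refine Or.inr ?_
          have := h.symm₂
          rw [Path.symm_symm] at this
          exact this.symm
      trans := by
        rintro γ δ ε (h | h) (h' | h')
        · exact Or.inl (h.trans h')
        · exact Or.inr (h.trans h')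
        · exact Or.inr (h.trans h'.symm₂)
        · refine Or.inl (h.trans ?_)
          have := h'.symm₂
          rwa [Path.symm_symm] at this }

/-- Arcs: homotopy classes of arc curves. -/
def Arc : Type := Quotient arcSetoid

/-- The arc represented by a curve. -/
def ArcCurve.arc (γ : ArcCurve) : Arc := Quotient.mk arcSetoid γ

/-- The points away from the puncture in which two curves meet. -/
def ArcCurve.crossings (γ δ : ArcCurve) : Set Torus :=
  (Set.range γ.path ∩ Set.range δ.path) \ {puncture}

/-- Two arcs are compatible if they have representatives that meet only at the puncture. -/
def Arc.Compatible (α β : Arc) : Prop :=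
  ∃ γ δ : ArcCurve, γ.arc = α ∧ δ.arc = β ∧ γ.crossings δ = ∅

open Classical in
/-- The least number of points in which representatives of two arcs meet away from the puncture;
the intersection number of an arc with itself is `0`. Only pairs of representatives with finitely
many common points compete, as `encard` has to be a natural number. -/
noncomputable def Arc.intersectionNumber (α β : Arc) : ℕ :=
  if α = β then 0
  else sInf {n : ℕ | ∃ γ δ : ArcCurve, γ.arc = α ∧ δ.arc = β ∧ (γ.crossings δ).encard = n}

/-! ### Triangulations, flips and intersection vectors -/

/-- An ordered triple of arcs is a triangulation if it is a maximal collection of distinct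
pairwise compatible arcs. -/
structure IsTriangulation (M : Fin 3 → Arc) : Prop where
  distinct : Function.Injective M
  compatible : ∀ i j, i ≠ j → (M i).Compatible (M j)
  maximal : ∀ α : Arc, (∀ i, α.Compatible (M i)) → ∃ i, α = M i

/-- The triangulation `M'` is obtained from the triangulation `M` by a flip in direction `k`:
the `k`-th arc is exchanged for another one. -/
structure IsFlip (k : Fin 3) (M M' : Fin 3 → Arc) : Prop where
  source : IsTriangulation M
  target : IsTriangulation M'
  fixed : ∀ j, j ≠ k → M' j = M j
  exchanged : M' k ≠ M k

/-- The intersection vector `D(M, ℓ)`. -/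
noncomputable def intersectionVector (M : Fin 3 → Arc) (ℓ : Arc) : Fin 3 → ℕ :=
  fun i => ℓ.intersectionNumber (M i)

/-! ### The 3-regular tree -/

/-- Vertices of the 3-regular tree with edges labelled `1, 2, 3`: a vertex is the sequence of the
labels met on the way from the rooted vertex to it, the last one at the head of the list.
Such a sequence is any sequence without equal neighbours. -/
def T3 : Type := {w : List (Fin 3) // w.IsChain (· ≠ ·)}

/-- The rooted vertex `t₀`. -/
def T3.t0 : T3 := ⟨[], List.isChain_nil⟩

/-- `t` and `t'` are joined by an edge labelled `k`. -/
def T3.Edge (k : Fin 3) (t t' : T3) : Prop := t'.1 = k :: t.1 ∨ t.1 = k :: t'.1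

/-- Every vertex is an endpoint of exactly one edge with a given label. -/
theorem T3.existsUnique_edge (t : T3) (k : Fin 3) : ∃! t' : T3, T3.Edge k t t' := by
  obtain ⟨w, hw⟩ := t
  rcases w with _ | ⟨a, w⟩
  · refine ⟨⟨[k], List.isChain_singleton k⟩, Or.inl rfl, ?_⟩
    rintro ⟨w', hw'⟩ (h | h)
    · exact Subtype.ext h
    · simp at h
  · by_cases hak : a = k
    · subst hak
      refine ⟨⟨w, hw.tail⟩, Or.inr rfl, ?_⟩
      rintro ⟨w', hw'⟩ (h | h)
      · simp only at h
        subst h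
        simp at hw'
      · simp only [List.cons.injEq, true_and] at h
        exact Subtype.ext h.symm
    · refine ⟨⟨k :: a :: w, List.isChain_cons_cons.2 ⟨Ne.symm hak, hw⟩⟩, Or.inl rfl, ?_⟩
      rintro ⟨w', hw'⟩ (h | h)
      · exact Subtype.ext h
      · simp only [List.cons.injEq] at h
        exact absurd h.1 hak

/-- An assignment of triangulations to the vertices of the 3-regular tree is a cluster pattern
with the initial triangulation `L` if `L` sits at `t₀` and triangulations joined by an edge
labelled `k` are obtained from each other by a flip in direction `k`. -/
structure IsClusterPattern (L : Fin 3 → Arc) (P : T3 → Fin 3 → Arc) : Prop where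
  initial : P T3.t0 = L
  flip : ∀ (k : Fin 3) (t t' : T3), T3.Edge k t t' → IsFlip k (P t) (P t')

/-- The vertices of the subtree behind the edge labelled `3` at `t₀`: those for which the first
label on the way from `t₀` is `3`. -/
def T3' : Type := {t : T3 // t.1.getLast? = some 2}

/-- The vertex `t₁` joined to `t₀` by the edge labelled `3`. -/
def T3'.t1 : T3' := ⟨⟨[2], List.isChain_singleton 2⟩, rfl⟩

/-- `t` and `t'` are joined by an edge labelled `k`. -/
def T3'.Edge (k : Fin 3) (t t' : T3') : Prop := T3.Edge k t.1 t'.1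

/-- `t` and `t'` are joined by an edge labelled `k`, and `t'` is the endpoint farther from `t₁`
(the distance to `t₁` is the length of the list minus one). -/
def T3'.Child (k : Fin 3) (t t' : T3') : Prop :=
  T3'.Edge k t t' ∧ t.1.1.length < t'.1.1.length

/-! ### Edge-labelled trees and the replacement of vertices -/

/-- A rooted tree with edges labelled by `1, 2, 3` and an element of `X` standing at each
vertex. -/
structure LabelledTree (X : Type) where
  Vertex : Type
  root : Vertex
  Edge : Fin 3 → Vertex → Vertex → Prop
  val : Vertex → X

/-- Replace what stands at each vertex by its image under `f`. -/
def LabelledTree.replace {X Y : Type} (T : LabelledTree X) (f : X → Y) : LabelledTree Y where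
  Vertex := T.Vertex
  root := T.root
  Edge := T.Edge
  val v := f (T.val v)

/-- Two labelled trees are the same: there is a bijection of the vertices that respects the root,
the edges with their labels, and what stands at the vertices. -/
def LabelledTree.Same {X : Type} (T U : LabelledTree X) : Prop :=
  ∃ φ : T.Vertex ≃ U.Vertex,
    φ T.root = U.root ∧
    (∀ k v w, T.Edge k v w ↔ U.Edge k (φ v) (φ w)) ∧
    ∀ v, T.val v = U.val (φ v)

/-- The vectors `D(L_t, ℓ)` for `t` in the subtree. -/
noncomputable def initialVector (P : T3 → Fin 3 → Arc) (ℓ : Arc) (t : T3') : Fin 3 → ℕ :=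
  intersectionVector (P t.1) ℓ

/-- The initial intersection vector tree: `D(L_t, ℓ)` stands at `t`. -/
noncomputable def initialIntersectionVectorTree (P : T3 → Fin 3 → Arc) (ℓ : Arc) :
    LabelledTree (Set.range (initialVector P ℓ)) where
  Vertex := T3'
  root := T3'.t1
  Edge := T3'.Edge
  val t := ⟨initialVector P ℓ t, t, rfl⟩

/-! ### The map `h` -/

/-- The inductive definition of `h` on the set of the vectors `d t`. The vector `d t` is mapped to
`(d t a + 1) / (d t b + 1)` with `a = num t` and `b = den t`; `c` is the third index. -/
structure IsRatioMap (d : T3' → Fin 3 → ℕ) (num den : T3' → Fin 3) (h : Set.range d → ℚ) :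
    Prop where
  num_root : num T3'.t1 = 0
  den_root : den T3'.t1 = 1
  root : h ⟨d T3'.t1, T3'.t1, rfl⟩ = ((d T3'.t1 0 : ℚ) + 1) / ((d T3'.t1 1 : ℚ) + 1)
  step_num : ∀ (k c : Fin 3) (t t' : T3'), T3'.Child k t t' → c ≠ num t → c ≠ den t →
    k = num t → num t' = c ∧ den t' = den t ∧
      h ⟨d t', t', rfl⟩ = ((d t c : ℚ) + 1) / ((d t (den t) : ℚ) + 1)
  step_den : ∀ (k c : Fin 3) (t t' : T3'), T3'.Child k t t' → c ≠ num t → c ≠ den t →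
    k = den t → num t' = num t ∧ den t' = c ∧
      h ⟨d t', t', rfl⟩ = ((d t (num t) : ℚ) + 1) / ((d t c : ℚ) + 1)

/-- The tree of the fractions `(d t a + 1) / (d t b + 1)` as written, that is, of the pairs
(numerator, denominator) before any cancellation. -/
def writtenFractionTree (d : T3' → Fin 3 → ℕ) (num den : T3' → Fin 3) :
    LabelledTree (ℕ × ℕ) where
  Vertex := T3'
  root := T3'.t1
  Edge := T3'.Edge
  val t := (d t (num t) + 1, d t (den t) + 1)

/-! ### The Calkin–Wilf tree -/

/-- The index different from `a` and `b`, for `a ≠ b`. -/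
def thirdLabel (a b : Fin 3) : Fin 3 := -(a + b)

theorem thirdLabel_ne (a b : Fin 3) (hab : a ≠ b) : thirdLabel a b ≠ a ∧ thirdLabel a b ≠ b := by
  revert a b
  decide

inductive Side where
  | left
  | right

/-- A fraction `x / y` in the Calkin–Wilf tree with the labels of the edges to its children. -/
structure CWNode where
  x : ℕ
  y : ℕ
  leftLabel : Fin 3
  rightLabel : Fin 3

/-- The children of `x / y` are `x / (x + y)` on the left and `(x + y) / y` on the right. If the
edges to them are labelled `a` and `b`, and `c` is the third label, then the edges from the left
child are labelled `c, b` and those from the right child `a, c` (left, right). -/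
def CWNode.child (n : CWNode) : Side → CWNode
  | .left => ⟨n.x, n.x + n.y, thirdLabel n.leftLabel n.rightLabel, n.rightLabel⟩
  | .right => ⟨n.x + n.y, n.y, n.leftLabel, thirdLabel n.leftLabel n.rightLabel⟩

/-- The node reached from the root `1 / 1` by a sequence of steps, the last one at the head.
The edge from `1 / 1` to `1 / 2` is labelled `2` and that to `2 / 1` is labelled `1`. -/
def cwNode : List Side → CWNode
  | [] => ⟨1, 1, 1, 0⟩
  | s :: p => (cwNode p).child s

/-- The label of the edge from a node to its child on the given side. -/
def CWNode.label (n : CWNode) : Side → Fin 3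
  | .left => n.leftLabel
  | .right => n.rightLabel

/-- The Calkin–Wilf tree; a fraction `x / y` is written as the pair `(x, y)`. -/
def calkinWilfTree : LabelledTree (ℕ × ℕ) where
  Vertex := List Side
  root := []
  Edge k p q := ∃ s : Side,
    (q = s :: p ∧ k = (cwNode p).label s) ∨ (p = s :: q ∧ k = (cwNode q).label s)
  val p := ((cwNode p).x, (cwNode p).y)

/-- The rational number given by a fraction. -/
def fractionValue (f : ℕ × ℕ) : ℚ := (f.1 : ℚ) / (f.2 : ℚ)

end PuncturedTorus

/-! Lifting an arc to the plane identifies arcs with primitive vectors of `ℤ²` up to sign. A simple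
loop in the class `u` and one in the class `v` meet in at least `|det u v|` points, the puncture
included, and geodesics attain this bound, so the intersection number of different arcs is
`|det u v| - 1` and triangulations are the triples with pairwise determinants `±1`. Such a triple
is `u, v, u + v` or `u, v, u - v` up to signs, and a flip exchanges one for the other. For every
`w` the larger of `|det w (u + v)|` and `|det w (u - v)|` is `|det w u| + |det w v|`; therefore,
away from `t₀`, a flip replaces the smaller of these numbers by the larger one. The entries of the
intersection vectors increased by one are then `x`, `y` and `x + y` for the nodes `x / y` of the
Calkin–Wilf tree, and the position of the largest entry recovers the path to the node. -/

namespace PuncturedTorus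

open Complex

/-! ### Continuous logarithms and plane curves -/

section Logarithm

variable {X : Type*} [TopologicalSpace X]

theorem eq_of_exp_eq [PreconnectedSpace X] {f : X → ℂ} (hf : Continuous f)
    (hexp : ∀ x y, exp (f x) = exp (f y)) (x y : X) : f x = f y :=
  isCoveringMap_exp.const_of_comp hf (fun x y ↦ Subtype.ext (hexp x y)) x y

theorem exists_continuous_log [SimplyConnectedSpace X] [LocallyPathConnectedSpace X] {f : X → ℂ}
    (hf : Continuous f) (h0 : ∀ x, f x ≠ 0) : ∃ F : X → ℂ, Continuous F ∧ ∀ x, exp (F x) = f x := by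
  obtain ⟨x₀⟩ : Nonempty X := inferInstance
  obtain ⟨F, ⟨-, hF⟩, -⟩ := isCoveringMap_exp.existsUnique_continuousMap_lifts
    ⟨fun x ↦ ⟨f x, h0 x⟩, hf.subtype_mk h0⟩ x₀ (log (f x₀)) (Subtype.ext (exp_log (h0 x₀)))
  exact ⟨F, F.continuous, fun x ↦ congrArg Subtype.val (congrFun hF x)⟩

theorem continuousOn_log_of_im_nonneg : ContinuousOn log {z | 0 ≤ z.im ∧ z ≠ 0} := by
  rintro z ⟨-, hz⟩
  by_cases hslit : z ∈ slitPlane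
  · exact (continuousAt_clog hslit).continuousWithinAt
  · obtain ⟨hre, him⟩ : z.re ≤ 0 ∧ z.im = 0 := by simpa [mem_slitPlane_iff] using hslit
    have hre : z.re < 0 := hre.lt_of_ne fun h ↦ hz (Complex.ext h him)
    exact (continuousWithinAt_log_of_re_neg_of_im_zero hre him).mono fun w hw ↦ hw.1

theorem sub_eq_log_sub_log [PreconnectedSpace X] {f F : X → ℂ} (hf : Continuous f)
    (hF : Continuous F) (hexp : ∀ x, exp (F x) = f x) (him : ∀ x, 0 ≤ (f x).im) (x y : X) :
    F x - F y = log (f x) - log (f y) := by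
  have h0 : ∀ x, f x ≠ 0 := fun x ↦ hexp x ▸ exp_ne_zero _
  have hlog : Continuous fun x ↦ log (f x) :=
    continuousOn_log_of_im_nonneg.comp_continuous hf fun x ↦ ⟨him x, h0 x⟩
  have hconst : F x - log (f x) = F y - log (f y) := eq_of_exp_eq (hF.sub hlog)
    (fun x y ↦ by simp [exp_sub, exp_log (h0 _), hexp, div_self (h0 _)]) x y
  linear_combination hconst

end Logarithm

/-- A continuous logarithm of `f` would gain `2 * π * I` along a circle of radius greater than `K`,
where `f z / z` stays in the slit plane. -/
theorem exists_eq_zero_of_norm_sub_le {f : ℂ → ℂ} (hf : Continuous f) {K : ℝ}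
    (hK : ∀ z, ‖f z - z‖ ≤ K) : ∃ z, f z = 0 := by
  by_contra! h0
  obtain ⟨F, hF, hexp⟩ := exists_continuous_log hf h0
  have hR : 0 < K + 1 := by linarith [(norm_nonneg _).trans (hK 0)]
  let z : ℝ → ℂ := circleMap 0 (K + 1)
  have hz : Continuous z := continuous_circleMap 0 (K + 1)
  have hz0 : ∀ θ, z θ ≠ 0 := fun θ ↦ circleMap_ne_center hR.ne'
  have hslit : ∀ θ, f (z θ) / z θ ∈ slitPlane := fun θ ↦ by
    have hlt : ‖f (z θ) / z θ - 1‖ < 1 := by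
      rw [div_sub_one (hz0 θ), norm_div, div_lt_one (norm_pos_iff.2 (hz0 θ))]
      simpa [z, abs_of_pos hR] using (hK (z θ)).trans_lt (lt_add_one K)
    simpa using mem_slitPlane_of_norm_lt_one hlt
  have hcont : Continuous fun θ : ℝ ↦ F (z θ) - log (f (z θ) / z θ) - θ * I :=
    ((hF.comp hz).sub (((hf.comp hz).div hz hz0).clog hslit)).sub (by fun_prop)
  have hexp' : ∀ θ : ℝ, exp (F (z θ) - log (f (z θ) / z θ) - θ * I) = (K + 1 : ℝ) := fun θ ↦ by
    rw [exp_sub, exp_sub, hexp, exp_log (slitPlane_ne_zero (hslit θ)), div_div_cancel₀ (h0 _)]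
    simp [z, circleMap_zero, exp_ne_zero]
  have hconst := eq_of_exp_eq hcont (fun θ θ' ↦ (hexp' θ).trans (hexp' θ').symm) 0 (2 * Real.pi)
  have hloop : z (2 * Real.pi) = z 0 := by simpa using periodic_circleMap 0 (K + 1) 0
  push_cast [hloop] at hconst
  exact two_pi_I_ne_zero (by linear_combination hconst)

/-- If `c s - c t - r` never vanished, its logarithm would change by an amount independent of `s`
as `t` runs from `s` to `s - 1`, since both end values `-r` and `g - r` are. But with `c s` at the
top of the curve it moves through the upper half-plane, and with `c s` at the bottom through the
lower one, so that the imaginary part changes by `-π` and by `π`. -/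
theorem exists_sub_eq_of_add_one {c : ℝ → ℂ} (hc : Continuous c) {g r : ℝ}
    (hper : ∀ s, c (s + 1) = c s + g) (hr : 0 < r) (hrg : r < g) : ∃ s t, c s - c t = r := by
  by_contra! hne
  have hf : Continuous fun p : ℝ × ℝ ↦ c p.1 - c p.2 - r := by fun_prop
  obtain ⟨F, hF, hexp⟩ := exists_continuous_log hf fun p ↦ sub_ne_zero.2 (hne p.1 p.2)
  have hdiag : ∀ s s', F (s, s) = F (s', s') :=
    eq_of_exp_eq (f := fun s ↦ F (s, s)) (by fun_prop) fun s s' ↦ by simp [hexp]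
  have hback : ∀ s, c s - c (s - 1) = g := fun s ↦ by
    rw [sub_eq_iff_eq_add', ← hper, sub_add_cancel]
  have hshift : ∀ s s', F (s, s - 1) = F (s', s' - 1) :=
    eq_of_exp_eq (f := fun s ↦ F (s, s - 1)) (by fun_prop) fun s s' ↦ by simp [hexp, hback]
  have himper : Function.Periodic (fun s ↦ (c s).im) 1 := fun s ↦ by simp [hper]
  have hcompact := himper.compact_of_continuous one_ne_zero (continuous_im.comp hc)
  obtain ⟨_, ⟨s, rfl⟩, hs⟩ := hcompact.exists_isGreatest (Set.range_nonempty _)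
  obtain ⟨_, ⟨s', rfl⟩, hs'⟩ := hcompact.exists_isLeast (Set.range_nonempty _)
  have htop := sub_eq_log_sub_log (f := fun t ↦ c s - c t - r) (F := fun t ↦ F (s, t))
    (by fun_prop) (by fun_prop) (fun t ↦ hexp (s, t))
    (fun t ↦ by simpa using hs ⟨t, rfl⟩) (s - 1) s
  have hbot := sub_eq_log_sub_log (f := fun t ↦ -(c s' - c t - r))
    (F := fun t ↦ F (s', t) + Real.pi * I) (by fun_prop) (by fun_prop)
    (fun t ↦ by simp [exp_add, hexp]) (fun t ↦ by simpa using hs' ⟨t, rfl⟩) (s' - 1) s'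
  have hleft : (F (s, s - 1) - F (s, s)).im = -Real.pi := by
    rw [htop, hback, sub_self, zero_sub, ← ofReal_sub, ← ofReal_neg, sub_im, log_im, log_im,
      arg_ofReal_of_nonneg (sub_pos.2 hrg).le, arg_ofReal_of_neg (neg_neg_of_pos hr), zero_sub]
  have hright : (F (s', s' - 1) - F (s', s')).im = Real.pi := by
    rw [← add_sub_add_right_eq_sub _ _ (Real.pi * I : ℂ), hbot, hback, sub_self, zero_sub, neg_neg,
      ← ofReal_sub, ← ofReal_neg, sub_im, log_im, log_im, arg_ofReal_of_nonneg hr.le,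
      arg_ofReal_of_neg (neg_neg_of_pos (sub_pos.2 hrg)), sub_zero]
  rw [hshift s s', hdiag s s', hright] at hleft
  linarith [Real.pi_pos]

/-! ### Lifts of loops -/

/-- The universal covering of the torus, with the plane `ℝ²` written as `ℂ`; the deck
transformations are the translations by Gaussian integers. -/
noncomputable def torusProj : ℂ →+ Torus where
  toFun z := ((z.re : AddCircle (1 : ℝ)), (z.im : AddCircle (1 : ℝ)))
  map_zero' := rfl
  map_add' _ _ := rfl

theorem torusProj_zero : torusProj 0 = puncture := rfl

theorem torusProj_eq_puncture_iff {z : ℂ} :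
    torusProj z = puncture ↔ ∃ w : GaussianInt, (w : ℂ) = z := by
  refine Prod.ext_iff.trans ?_
  change (z.re : AddCircle (1 : ℝ)) = 0 ∧ (z.im : AddCircle (1 : ℝ)) = 0 ↔ _
  simp only [AddCircle.coe_eq_zero_iff, zsmul_eq_mul, mul_one]
  constructor
  · rintro ⟨⟨m, hm⟩, n, hn⟩
    exact ⟨⟨m, n⟩, Complex.ext (by simpa using hm) (by simpa using hn)⟩
  · rintro ⟨w, rfl⟩
    exact ⟨⟨w.re, w.intCast_re⟩, w.im, w.intCast_im⟩

theorem torusProj_coe (w : GaussianInt) : torusProj w = 0 :=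
  torusProj_eq_puncture_iff.2 ⟨w, rfl⟩

theorem torusProj_eq_iff {z z' : ℂ} :
    torusProj z = torusProj z' ↔ ∃ w : GaussianInt, (w : ℂ) = z - z' := by
  rw [← torusProj_eq_puncture_iff, map_sub]
  exact sub_eq_zero.symm

theorem isCoveringMap_torusProj : IsCoveringMap torusProj := by
  have hquot : Topology.IsQuotientMap torusProj :=
    ((QuotientAddGroup.isOpenQuotientMap_mk.prodMap QuotientAddGroup.isOpenQuotientMap_mk).comp
      equivRealProdCLM.toHomeomorph.isOpenQuotientMap).isQuotientMap
  have hdisc : DiscreteTopology torusProj.ker := by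
    refine DiscreteTopology.of_forall_le_norm one_pos fun ⟨z, hz⟩ hz0 ↦ ?_
    obtain ⟨w, rfl⟩ := torusProj_eq_puncture_iff.1 hz
    have hw : w ≠ 0 := by rintro rfl; exact hz0 (Subtype.ext GaussianInt.toComplex_zero)
    rw [AddSubgroup.coe_norm, ← one_le_sq_iff₀ (norm_nonneg _), ← normSq_eq_norm_sq,
      ← GaussianInt.intCast_real_norm]
    exact_mod_cast GaussianInt.norm_pos.2 hw
  exact (hquot.isAddQuotientCoveringMap_of_isDiscrete_ker_addMonoidHom ⟨hdisc⟩).isCoveringMap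

section Lift

variable (p q : Path puncture puncture)

theorem exists_lift : ∃ Γ : C(ℝ, ℂ), Γ 0 = 0 ∧ ∀ s, torusProj (Γ s) = p.extend (Int.fract s) := by
  have hcont : Continuous (p.extend ∘ Int.fract) :=
    ContinuousOn.comp_fract'' p.continuous_extend.continuousOn (by simp)
  obtain ⟨Γ, ⟨hΓ0, hΓ⟩, -⟩ := isCoveringMap_torusProj.existsUnique_continuousMap_lifts
    ⟨_, hcont⟩ 0 0 (torusProj_zero.trans (by simp))
  exact ⟨Γ, hΓ0, congrFun hΓ⟩

/-- The lift to the plane, starting at `0`, of the loop `p` run through over and over again. -/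
noncomputable def lift : C(ℝ, ℂ) := (exists_lift p).choose

theorem lift_zero : lift p 0 = 0 := (exists_lift p).choose_spec.1

theorem torusProj_lift (s : ℝ) : torusProj (lift p s) = p.extend (Int.fract s) :=
  (exists_lift p).choose_spec.2 s

theorem torusProj_lift_coe (s : unitInterval) : torusProj (lift p s) = p s := by
  rcases s.2.2.lt_or_eq with hs | hs
  · rw [torusProj_lift, Int.fract_eq_self.2 ⟨s.2.1, hs⟩, p.extend_apply s.2]
  · rw [torusProj_lift, hs, Int.fract_one, p.extend_zero, show s = 1 from Subtype.ext hs, p.target]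

theorem exists_lift_one : ∃ w : GaussianInt, (w : ℂ) = lift p 1 :=
  torusProj_eq_puncture_iff.1 (by simp [torusProj_lift])

/-- The class of the loop `p` in `H₁(ℝ² / ℤ²) = ℤ[i]`: the endpoint of its lift. -/
noncomputable def homologyClass : GaussianInt := (exists_lift_one p).choose

theorem lift_one : lift p 1 = homologyClass p := (exists_lift_one p).choose_spec.symm

theorem lift_add_one (s : ℝ) : lift p (s + 1) = lift p s + homologyClass p := by
  have hfun : (fun s ↦ lift p (s + 1)) = fun s ↦ lift p s + homologyClass p := by
    refine isCoveringMap_torusProj.eq_of_comp_eq (by fun_prop) (by fun_prop) (funext fun s ↦ ?_) 0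
      (by simp [lift_zero, lift_one])
    simp [torusProj_lift, torusProj_coe]
  exact congrFun hfun s

theorem periodic_lift_sub : Function.Periodic (fun s ↦ lift p s - s * homologyClass p) 1 :=
  fun s ↦ by
    push_cast [lift_add_one]
    ring

theorem lift_add_intCast (s : ℝ) (k : ℤ) : lift p (s + k) = lift p s + k * homologyClass p := by
  have hper := (periodic_lift_sub p).int_mul k s
  push_cast [mul_one] at hper
  linear_combination hper

variable {p q}

theorem lift_eqOn {Γ : unitInterval → ℂ} (hΓ : Continuous Γ) (hproj : ∀ s, torusProj (Γ s) = p s)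
    (s : unitInterval) : Γ s - Γ 0 = lift p s := by
  have hΓ0 : torusProj (Γ 0) = 0 := (hproj 0).trans p.source
  refine congrFun (isCoveringMap_torusProj.eq_of_comp_eq (g₁ := fun s ↦ Γ s - Γ 0)
    (g₂ := fun s : unitInterval ↦ lift p s) (by fun_prop) (by fun_prop) (funext fun s ↦ ?_) 0
    (by simp [lift_zero])) s
  simp only [Function.comp_apply, map_sub, hΓ0, sub_zero, hproj, torusProj_lift_coe]

theorem homologyClass_eq_iff : homologyClass p = homologyClass q ↔ p.Homotopic q := by
  refine ⟨fun h ↦ ?_, fun ⟨h⟩ ↦ ?_⟩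
  · let liftPath (p : Path puncture puncture) (w : ℂ) (hw : lift p 1 = w) : Path (0 : ℂ) w :=
      ⟨(lift p).comp ⟨_, continuous_subtype_val⟩, by simp [lift_zero], by simp [hw]⟩
    have hmap : ∀ p w hw,
        (⟨torusProj, isCoveringMap_torusProj.continuous⟩ : C(ℂ, Torus)).comp
          (liftPath p w hw).toContinuousMap = p.toContinuousMap :=
      fun p w hw ↦ ContinuousMap.ext fun s ↦ torusProj_lift_coe p s
    have hq : lift q 1 = homologyClass p := by rw [lift_one, h]
    have hhom := ContinuousMap.HomotopicRel.comp_continuousMap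
      (SimplyConnectedSpace.paths_homotopic (liftPath p _ (lift_one p)) (liftPath q _ hq))
      ⟨torusProj, isCoveringMap_torusProj.continuous⟩
    rwa [hmap _ _ (lift_one p), hmap _ _ hq] at hhom
  · have hsource : ∀ p : Path puncture puncture, p.toContinuousMap 0 = torusProj 0 :=
      fun p ↦ p.source.trans torusProj_zero.symm
    have hlift : ∀ p : Path puncture puncture, lift p 1 =
        isCoveringMap_torusProj.liftPath p.toContinuousMap 0 (hsource p) 1 := fun p ↦
      congrFun ((isCoveringMap_torusProj.eq_liftPath_iff _ (Γ := fun s ↦ lift p s)).2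
        ⟨by fun_prop, funext (torusProj_lift_coe p), lift_zero p⟩) 1
    refine GaussianInt.toComplex_injective ?_
    rw [← lift_one, ← lift_one, hlift, hlift]
    exact isCoveringMap_torusProj.liftPath_apply_one_eq_of_homotopicRel ⟨h⟩ 0 _ _

theorem homologyClass_refl : homologyClass (Path.refl puncture) = 0 := by
  have := lift_eqOn (p := Path.refl puncture) (Γ := fun _ ↦ 0) continuous_const
    (fun _ ↦ map_zero torusProj) 1
  exact GaussianInt.toComplex_injective (by simpa [lift_one] using this.symm)

theorem homologyClass_symm : homologyClass p.symm = -homologyClass p := by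
  have := lift_eqOn (p := p.symm) (Γ := fun s ↦ lift p (unitInterval.symm s)) (by fun_prop)
    (fun s ↦ torusProj_lift_coe p _) 1
  exact GaussianInt.toComplex_injective (by simpa [lift_zero, lift_one] using this.symm)

end Lift

/-! ### Primitive vectors and geodesic arcs -/

/-- The oriented area of the parallelogram spanned by `u` and `v`. -/
def det (u v : GaussianInt) : ℤ := u.re * v.im - u.im * v.re

theorem det_self (u : GaussianInt) : det u u = 0 := by
  simp only [det]
  ring

theorem det_neg_left (u v : GaussianInt) : det (-u) v = -det u v := by
  simp only [det, Zsqrtd.re_neg, Zsqrtd.im_neg]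
  ring

theorem det_neg_right (u v : GaussianInt) : det u (-v) = -det u v := by
  simp only [det, Zsqrtd.re_neg, Zsqrtd.im_neg]
  ring

theorem det_add_right (u v w : GaussianInt) : det u (v + w) = det u v + det u w := by
  simp only [det, Zsqrtd.re_add, Zsqrtd.im_add]
  ring

theorem det_sub_right (u v w : GaussianInt) : det u (v - w) = det u v - det u w := by
  simp only [det, Zsqrtd.re_sub, Zsqrtd.im_sub]
  ring

theorem det_intCast_mul_right (k : ℤ) (u v : GaussianInt) : det u (k * v) = k * det u v := by
  simp only [det, Zsqrtd.re_smul, Zsqrtd.im_smul]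
  ring

theorem exists_det_eq_one {u : GaussianInt} (hu : IsCoprime u.re u.im) : ∃ z, det u z = 1 := by
  obtain ⟨a, b, hab⟩ := hu
  exact ⟨⟨-b, a⟩, by simp only [det]; linear_combination hab⟩

theorem eq_or_eq_neg_of_det_eq_zero {u v : GaussianInt} (hu : IsCoprime u.re u.im)
    (hv : IsCoprime v.re v.im) (h : det u v = 0) : u = v ∨ u = -v := by
  obtain ⟨a, b, hab⟩ := hu
  obtain ⟨e, hre, him⟩ : ∃ e, v.re = e * u.re ∧ v.im = e * u.im := by
    rw [det] at h
    exact ⟨a * v.re + b * v.im, by linear_combination -v.re * hab - b * h,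
      by linear_combination -v.im * hab + a * h⟩
  have he : IsUnit e := hv.isUnit_of_dvd' ⟨_, hre⟩ ⟨_, him⟩
  rcases Int.isUnit_iff.1 he with rfl | rfl
  · exact .inl (Zsqrtd.ext (by simp [hre]) (by simp [him]))
  · exact .inr (Zsqrtd.ext (by simp [hre]) (by simp [him]))

theorem isCoprime_of_natAbs_det_eq_one {u v : GaussianInt} (h : (det u v).natAbs = 1) :
    IsCoprime v.re v.im := by
  rw [det] at h
  rcases Int.natAbs_eq_iff.1 h with h | h
  · exact ⟨-u.im, u.re, by linear_combination h⟩
  · exact ⟨u.im, -u.re, by linear_combination -h⟩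

theorem eq_or_eq_neg_of_natAbs_det_eq_one {u v w : GaussianInt} (huv : (det u v).natAbs = 1)
    (huw : (det u w).natAbs = 1) (hvw : (det v w).natAbs = 1) :
    (w = u + v ∨ w = -(u + v)) ∨ (w = u - v ∨ w = -(u - v)) := by
  have hw : (det u v : GaussianInt) * w = -det v w * u + det u w * v :=
    Zsqrtd.ext (by simp [det]; ring) (by simp [det]; ring)
  rw [Int.natAbs_eq_iff] at huv huw hvw
  rcases huv with huv | huv <;> rcases huw with huw | huw <;> rcases hvw with hvw | hvw <;>
    simp only [huv, huw, hvw, Nat.cast_one, Int.cast_neg, Int.cast_one] at hw <;> grind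

/-- The Plücker relation. -/
theorem det_mul_det (u v w z : GaussianInt) :
    det u v * det w z + det u z * det v w = det u w * det v z := by
  simp only [det]
  ring

theorem exists_coordinates {u v : GaussianInt} (huv : det u v ≠ 0) :
    ∃ s t : ℂ → ℝ, Continuous s ∧ Continuous t ∧ ∀ z, (s z : ℂ) * u - (t z : ℂ) * v = z := by
  have hD : (u.re * v.im - u.im * v.re : ℝ) ≠ 0 := by exact_mod_cast huv
  refine ⟨fun z ↦ (z.re * v.im - z.im * v.re) / (u.re * v.im - u.im * v.re),
    fun z ↦ (z.re * u.im - z.im * u.re) / (u.re * v.im - u.im * v.re),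
    by fun_prop, by fun_prop, fun z ↦ Complex.ext ?_ ?_⟩ <;>
  · simp only [sub_re, sub_im, re_ofReal_mul, im_ofReal_mul, ← GaussianInt.intCast_re,
      ← GaussianInt.intCast_im]
    rw [div_mul_eq_mul_div, div_mul_eq_mul_div, ← sub_div, div_eq_iff hD]
    ring

theorem eq_intCast_of_coe_eq_mul {u w : GaussianInt} (hu : IsCoprime u.re u.im) {r : ℝ}
    (h : (w : ℂ) = (r : ℂ) * u) : ∃ k : ℤ, r = k := by
  obtain ⟨a, b, hab⟩ := hu
  have hre : (w.re : ℝ) = r * u.re := by simpa using congrArg re h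
  have him : (w.im : ℝ) = r * u.im := by simpa using congrArg im h
  have habR : (a * u.re + b * u.im : ℝ) = 1 := by exact_mod_cast hab
  refine ⟨a * w.re + b * w.im, ?_⟩
  push_cast
  linear_combination -r * habR - a * hre - b * him

/-- The closed geodesic on the torus in the direction of `u`. -/
noncomputable def straightPath (u : GaussianInt) : Path puncture puncture where
  toFun s := torusProj ((s : ℝ) * u : ℂ)
  continuous_toFun := isCoveringMap_torusProj.continuous.comp (by fun_prop)
  source' := torusProj_eq_puncture_iff.2 ⟨0, by simp⟩
  target' := torusProj_eq_puncture_iff.2 ⟨u, by simp⟩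

theorem homologyClass_straightPath (u : GaussianInt) : homologyClass (straightPath u) = u := by
  have := lift_eqOn (p := straightPath u) (Γ := fun s ↦ ((s : ℝ) : ℂ) * u) (by fun_prop)
    (fun _ ↦ rfl) 1
  exact GaussianInt.toComplex_injective (by simpa [lift_one] using this.symm)

/-- The geodesic arc in a primitive direction `u`. -/
noncomputable def straightCurve (u : GaussianInt) (hu : IsCoprime u.re u.im) : ArcCurve where
  path := straightPath u
  simple s t h := by
    obtain ⟨w, hw⟩ := torusProj_eq_iff.1 h
    obtain ⟨k, hk⟩ := eq_intCast_of_coe_eq_mul hu (r := s - t) (by push_cast; rw [hw]; ring)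
    obtain ⟨⟨hs0, hs1⟩, ht0, ht1⟩ := s.2, t.2
    have hk1 : k ≤ 1 := by exact_mod_cast (by linarith : (k : ℝ) ≤ 1)
    have hk2 : -1 ≤ k := by exact_mod_cast (by linarith : (-1 : ℝ) ≤ k)
    simp only [Subtype.ext_iff, Set.Icc.coe_zero, Set.Icc.coe_one]
    obtain rfl | rfl | rfl : k = -1 ∨ k = 0 ∨ k = 1 := by omega
    all_goals push_cast at hk
    · exact .inr (.inl ⟨by linarith, by linarith⟩)
    · exact .inl (by linarith)
    · exact .inr (.inr ⟨by linarith, by linarith⟩)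
  essential h := by
    have := homologyClass_eq_iff.2 h
    rw [homologyClass_straightPath, homologyClass_refl] at this
    exact not_isCoprime_zero_zero (this ▸ hu)

namespace ArcCurve

variable (γ δ : ArcCurve)

theorem homologyClass_ne_zero : homologyClass γ.path ≠ 0 := fun h ↦
  γ.essential (homologyClass_eq_iff.1 (h.trans homologyClass_refl.symm))

theorem eq_mul_of_lift_sub_eq {s t : ℝ} {w : GaussianInt}
    (h : lift γ.path s - lift γ.path t = w) : ∃ k : ℤ, w = k * homologyClass γ.path := by
  have hproj : γ.path ⟨Int.fract s, unitInterval.fract_mem s⟩ =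
      γ.path ⟨Int.fract t, unitInterval.fract_mem t⟩ := by
    rw [← γ.path.extend_apply, ← γ.path.extend_apply, ← torusProj_lift, ← torusProj_lift,
      torusProj_eq_iff]
    exact ⟨w, h.symm⟩
  have hfract : Int.fract s = Int.fract t := by
    rcases γ.simple _ _ hproj with h | ⟨-, h⟩ | ⟨h, -⟩
    · exact congrArg Subtype.val h
    · exact absurd (congrArg Subtype.val h) (Int.fract_lt_one t).ne
    · exact absurd (congrArg Subtype.val h) (Int.fract_lt_one s).ne
  obtain ⟨k, hk⟩ := Int.fract_eq_fract.1 hfract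
  refine ⟨k, GaussianInt.toComplex_injective ?_⟩
  rw [← h, sub_eq_iff_eq_add'.1 hk, lift_add_intCast]
  simp

theorem isCoprime_homologyClass :
    IsCoprime (homologyClass γ.path).re (homologyClass γ.path).im := by
  set u := homologyClass γ.path with hu
  have hpos : 0 < Int.gcd u.re u.im :=
    Nat.pos_of_ne_zero fun h ↦ γ.homologyClass_ne_zero (Zsqrtd.ext_iff.2 (Int.gcd_eq_zero_iff.1 h))
  obtain ⟨v, huv, hv⟩ := Zsqrtd.exists_coprime_of_gcd_pos hpos
  set g := Int.gcd u.re u.im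
  have hv0 : v ≠ 0 := fun h ↦ not_isCoprime_zero_zero (h ▸ hv)
  have hv0' : (v : ℂ) ≠ 0 := mt GaussianInt.toComplex_eq_zero.1 hv0
  suffices hg : ¬ 1 < g by
    obtain rfl : u = v := by simpa [show g = 1 by omega] using huv
    exact hv
  intro hg
  have huvC : (u : ℂ) = g * v := by rw [huv]; simp
  obtain ⟨s, t, hst⟩ := exists_sub_eq_of_add_one (c := fun s ↦ lift γ.path s / v) (g := g) (r := 1)
    (by fun_prop) (fun s ↦ by
      rw [lift_add_one, ← hu, huvC, add_div, mul_div_cancel_right₀ _ hv0', ofReal_natCast])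
    one_pos (by exact_mod_cast hg)
  rw [← sub_div, div_eq_iff hv0', ofReal_one, one_mul] at hst
  obtain ⟨k, hk⟩ := γ.eq_mul_of_lift_sub_eq hst
  have hkg : (g : ℤ) * k = 1 := by
    have : ((g * k : ℤ) : GaussianInt) * v = (1 : ℤ) * v := by
      conv_rhs => rw [hk, ← hu, huv]
      push_cast
      ring
    exact_mod_cast mul_right_cancel₀ hv0 this
  have := Int.eq_one_or_neg_one_of_mul_eq_one hkg
  omega

theorem arc_eq_arc_iff : γ.arc = δ.arc ↔
    homologyClass γ.path = homologyClass δ.path ∨ homologyClass γ.path = -homologyClass δ.path := by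
  rw [← homologyClass_symm, homologyClass_eq_iff, homologyClass_eq_iff]
  exact Quotient.eq (r := arcSetoid)

end ArcCurve

/-! ### Intersection numbers -/

theorem exists_norm_lift_sub_le (p : Path puncture puncture) :
    ∃ K, ∀ s : ℝ, ‖lift p s - s * homologyClass p‖ ≤ K := by
  obtain ⟨K, hK⟩ := ((periodic_lift_sub p).isBounded_of_continuous one_ne_zero
    (by fun_prop)).exists_norm_le
  exact ⟨K, fun s ↦ hK _ ⟨s, rfl⟩⟩

theorem exists_lift_sub_lift_eq {p q : Path puncture puncture}
    (hpq : det (homologyClass p) (homologyClass q) ≠ 0) (z : ℂ) :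
    ∃ s t, lift p s - lift q t = z := by
  obtain ⟨s, t, hs, ht, hst⟩ := exists_coordinates hpq
  obtain ⟨K, hK⟩ := exists_norm_lift_sub_le p
  obtain ⟨K', hK'⟩ := exists_norm_lift_sub_le q
  obtain ⟨w, hw⟩ := exists_eq_zero_of_norm_sub_le
    (f := fun w ↦ lift p (s w) - lift q (t w) - z) (K := K + K' + ‖z‖) (by fun_prop) fun w ↦ by
      calc ‖lift p (s w) - lift q (t w) - z - w‖
        _ = ‖lift p (s w) - s w * homologyClass p - (lift q (t w) - t w * homologyClass q) - z‖ :=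
          congrArg norm (by linear_combination hst w)
        _ ≤ K + K' + ‖z‖ :=
          (norm_sub_le _ _).trans
            (add_le_add_left ((norm_sub_le _ _).trans (add_le_add (hK _) (hK' _))) _)
  exact ⟨s w, t w, sub_eq_zero.1 hw⟩

theorem torusProj_lift_mem_range (p : Path puncture puncture) (s : ℝ) :
    torusProj (lift p s) ∈ Set.range p := by
  rw [torusProj_lift, p.extend_apply (unitInterval.fract_mem s)]
  exact Set.mem_range_self _

theorem encard_int_Ico (n : ℕ) : (Set.Ico (0 : ℤ) n).encard = n := by
  rw [← Finset.coe_Ico, Set.encard_coe_eq_coe_finsetCard, Int.card_Ico, sub_zero, Int.toNat_natCast]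

/-- With `z` such that `det u z = 1`, the lift of `γ` meets the lift of `δ` translated by `j * z`
for every `j`. As `γ` and `δ` are simple, two such points agree on the torus only if the values of
`j` are congruent modulo `det u v`. -/
theorem ArcCurve.natAbs_det_le_encard (γ δ : ArcCurve) :
    ((det (homologyClass γ.path) (homologyClass δ.path)).natAbs : ℕ∞) ≤
      (Set.range γ.path ∩ Set.range δ.path).encard := by
  set u := homologyClass γ.path
  set v := homologyClass δ.path
  rcases eq_or_ne (det u v) 0 with h0 | h0
  · simp [h0]
  obtain ⟨z, hz⟩ := exists_det_eq_one γ.isCoprime_homologyClass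
  choose s t hst using fun j : ℤ ↦ exists_lift_sub_lift_eq h0 ((j : ℂ) * z)
  rw [← encard_int_Ico]
  refine Set.encard_le_encard_of_injOn (f := fun j ↦ torusProj (lift γ.path (s j)))
    (fun j _ ↦ ⟨torusProj_lift_mem_range _ _, ?_⟩) fun i hi j hj hij ↦ ?_
  · convert torusProj_lift_mem_range δ.path (t j) using 1
    refine torusProj_eq_iff.2 ⟨j * z, ?_⟩
    simp [hst]
  · obtain ⟨w, hw⟩ := torusProj_eq_iff.1 hij
    obtain ⟨k, hk⟩ := γ.eq_mul_of_lift_sub_eq hw.symm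
    obtain ⟨l, hl⟩ := δ.eq_mul_of_lift_sub_eq (s := t i) (t := t j) (w := w - (i - j : ℤ) * z) (by
      simp only [GaussianInt.toComplex_sub, GaussianInt.toComplex_mul, map_intCast, hw]
      push_cast
      linear_combination hst j - hst i)
    have hdvd : det u v ∣ i - j := ⟨-l, by
      have hdet := congrArg (det u) hl
      rw [hk, det_sub_right, det_intCast_mul_right, det_intCast_mul_right, det_intCast_mul_right,
        hz, det_self] at hdet
      linear_combination -hdet⟩
    exact sub_eq_zero.1 (Int.eq_zero_of_dvd_of_natAbs_lt_natAbs hdvd (by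
      simp only [Set.mem_Ico] at hi hj
      omega))

theorem encard_range_straightCurve_inter_le {u v : GaussianInt} (hu : IsCoprime u.re u.im)
    (hv : IsCoprime v.re v.im) (huv : det u v ≠ 0) :
    (Set.range (straightCurve u hu).path ∩ Set.range (straightCurve v hv).path).encard ≤
      (det u v).natAbs := by
  set n := (det u v).natAbs with hn
  have hn0 : (0 : ℝ) < n := by exact_mod_cast Int.natAbs_pos.2 huv
  rw [← encard_int_Ico]
  refine (Set.encard_le_encard ?_).trans
    (Set.encard_image_le (fun j : ℤ ↦ torusProj (((j / n : ℝ) : ℂ) * u)) _)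
  rintro _ ⟨⟨s, rfl⟩, t, ht⟩
  obtain ⟨w, hw⟩ := torusProj_eq_iff.1 ht
  have hre : (w.re : ℝ) = t * v.re - s * u.re := by simpa using congrArg re hw
  have him : (w.im : ℝ) = t * v.im - s * u.im := by simpa using congrArg im hw
  have hdet : (s : ℝ) * det u v = -det w v := by
    simp only [det]
    push_cast
    linear_combination v.im * hre - v.re * him
  have hsn : (s : ℝ) * n = |det w v| := by
    rw [hn, Nat.cast_natAbs, Int.cast_abs, Int.cast_abs, ← abs_neg (det w v : ℝ), ← hdet, abs_mul,
      abs_of_nonneg s.2.1]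
  rcases s.2.2.lt_or_eq with hs | hs
  · refine ⟨|det w v|, ⟨abs_nonneg _, ?_⟩, ?_⟩
    · have : (s : ℝ) * n < n := mul_lt_of_lt_one_left hn0 hs
      exact_mod_cast hsn ▸ this
    · dsimp only
      rw [← hsn, mul_div_cancel_right₀ _ hn0.ne']
      rfl
  · obtain rfl : s = 1 := Subtype.ext hs
    exact ⟨0, ⟨le_rfl, by exact_mod_cast hn0⟩, by
      rw [Path.target]
      simp [puncture, ← Prod.zero_eq_mk]⟩

theorem ArcCurve.encard_crossings_add_one (γ δ : ArcCurve) :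
    (γ.crossings δ).encard + 1 = (Set.range γ.path ∩ Set.range δ.path).encard :=
  Set.encard_sdiff_singleton_add_one ⟨⟨0, γ.path.source⟩, 0, δ.path.source⟩

namespace Arc

/-- A chosen representative of an arc. -/
noncomputable def curve (α : Arc) : ArcCurve := Quotient.out α

theorem arc_curve (α : Arc) : α.curve.arc = α := Quotient.out_eq α

/-- The homology class of an arc. Arcs carry no orientation, so this class is defined only up to
sign; the sign is that of the chosen representative. -/
noncomputable def vector (α : Arc) : GaussianInt := homologyClass α.curve.path

theorem isCoprime_vector (α : Arc) : IsCoprime α.vector.re α.vector.im :=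
  α.curve.isCoprime_homologyClass

theorem eq_iff_vector {α β : Arc} : α = β ↔ α.vector = β.vector ∨ α.vector = -β.vector := by
  rw [vector, vector, ← ArcCurve.arc_eq_arc_iff, arc_curve, arc_curve]

theorem vector_arc (γ : ArcCurve) :
    γ.arc.vector = homologyClass γ.path ∨ γ.arc.vector = -homologyClass γ.path :=
  (ArcCurve.arc_eq_arc_iff _ γ).1 γ.arc.arc_curve

/-- The number of points, including the puncture, in which the geodesics in the classes of two
different arcs meet. -/
noncomputable def absDet (α β : Arc) : ℕ := (det α.vector β.vector).natAbs

theorem absDet_arc (γ δ : ArcCurve) :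
    γ.arc.absDet δ.arc = (det (homologyClass γ.path) (homologyClass δ.path)).natAbs := by
  rw [absDet]
  rcases vector_arc γ with hγ | hγ <;> rcases vector_arc δ with hδ | hδ <;>
    simp only [hγ, hδ, det_neg_left, det_neg_right, Int.natAbs_neg]

theorem absDet_comm (α β : Arc) : α.absDet β = β.absDet α := by
  rw [absDet, absDet, ← Int.natAbs_neg, det, det]
  congr 1
  ring

theorem absDet_self (α : Arc) : α.absDet α = 0 := by
  rw [absDet, det_self, Int.natAbs_zero]

theorem absDet_eq_zero_iff {α β : Arc} : α.absDet β = 0 ↔ α = β :=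
  ⟨fun h ↦ eq_iff_vector.2 (eq_or_eq_neg_of_det_eq_zero α.isCoprime_vector β.isCoprime_vector
    (Int.natAbs_eq_zero.1 h)), fun h ↦ h ▸ α.absDet_self⟩

theorem arc_straightCurve_vector (α : Arc) :
    (straightCurve α.vector α.isCoprime_vector).arc = α := by
  rw [← arc_curve α, ArcCurve.arc_eq_arc_iff, arc_curve]
  exact .inl (homologyClass_straightPath _)

theorem absDet_le_encard_crossings_add_one (γ δ : ArcCurve) :
    (γ.arc.absDet δ.arc : ℕ∞) ≤ (γ.crossings δ).encard + 1 := by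
  rw [absDet_arc, γ.encard_crossings_add_one]
  exact γ.natAbs_det_le_encard δ

theorem exists_encard_crossings_add_one_eq {α β : Arc} (h : α ≠ β) :
    ∃ γ δ : ArcCurve, γ.arc = α ∧ δ.arc = β ∧ (γ.crossings δ).encard + 1 = α.absDet β := by
  refine ⟨_, _, α.arc_straightCurve_vector, β.arc_straightCurve_vector, le_antisymm ?_ ?_⟩
  · rw [ArcCurve.encard_crossings_add_one]
    exact encard_range_straightCurve_inter_le _ _ (Int.natAbs_ne_zero.1 (mt absDet_eq_zero_iff.1 h))
  · simpa only [arc_straightCurve_vector] using absDet_le_encard_crossings_add_one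
      (straightCurve _ α.isCoprime_vector) (straightCurve _ β.isCoprime_vector)

theorem intersectionNumber_eq (α β : Arc) : α.intersectionNumber β = α.absDet β - 1 := by
  rw [intersectionNumber]
  split_ifs with h
  · rw [absDet_eq_zero_iff.2 h]
  refine IsLeast.csInf_eq ⟨?_, ?_⟩
  · obtain ⟨γ, δ, hγ, hδ, hγδ⟩ := exists_encard_crossings_add_one_eq h
    refine ⟨γ, δ, hγ, hδ, ?_⟩
    have hpos : 1 ≤ α.absDet β := Nat.one_le_iff_ne_zero.2 (mt absDet_eq_zero_iff.1 h)
    rw [← Nat.sub_add_cancel hpos, Nat.cast_add, Nat.cast_one] at hγδ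
    exact WithTop.add_right_cancel ENat.one_ne_top hγδ
  · rintro n ⟨γ, δ, rfl, rfl, hn⟩
    have := absDet_le_encard_crossings_add_one γ δ
    rw [hn] at this
    exact Nat.sub_le_iff_le_add.2 (by exact_mod_cast this)

theorem compatible_iff {α β : Arc} (h : α ≠ β) : α.Compatible β ↔ α.absDet β = 1 := by
  constructor
  · rintro ⟨γ, δ, rfl, rfl, hγδ⟩
    have hle := absDet_le_encard_crossings_add_one γ δ
    rw [hγδ, Set.encard_empty, zero_add] at hle
    exact le_antisymm (by exact_mod_cast hle) (Nat.one_le_iff_ne_zero.2 (mt absDet_eq_zero_iff.1 h))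
  · intro hdet
    obtain ⟨γ, δ, hγ, hδ, hγδ⟩ := exists_encard_crossings_add_one_eq h
    refine ⟨γ, δ, hγ, hδ, Set.encard_eq_zero.1 ?_⟩
    rw [hdet, Nat.cast_one] at hγδ
    exact WithTop.add_right_cancel ENat.one_ne_top (hγδ.trans (zero_add 1).symm)

/-- The Plücker relation modulo 2: a sum of two odd numbers is not odd. -/
theorem not_pairwise_absDet_eq_one {α β γ δ : Arc} (hαβ : α.absDet β = 1) (hαγ : α.absDet γ = 1)
    (hαδ : α.absDet δ = 1) (hβγ : β.absDet γ = 1) (hβδ : β.absDet δ = 1) : γ.absDet δ ≠ 1 := by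
  have odd_det {α β : Arc} (h : α.absDet β = 1) : Odd (det α.vector β.vector) :=
    Int.natAbs_odd.1 (Nat.odd_iff.2 (congrArg (· % 2) h))
  intro hγδ
  have heven := ((odd_det hαβ).mul (odd_det hγδ)).add_odd ((odd_det hαδ).mul (odd_det hβγ))
  rw [det_mul_det] at heven
  exact Int.not_even_iff_odd.2 ((odd_det hαγ).mul (odd_det hβδ)) heven

theorem exists_vector {u : GaussianInt} (hu : IsCoprime u.re u.im) :
    ∃ σ : Arc, (∀ α : Arc, α = σ ↔ α.vector = u ∨ α.vector = -u) ∧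
      ∀ α : Arc, α.absDet σ = (det α.vector u).natAbs := by
  refine ⟨(straightCurve u hu).arc, fun α ↦ ?_, fun α ↦ ?_⟩
  · conv_lhs => rw [← α.arc_curve, ArcCurve.arc_eq_arc_iff]
    rw [straightCurve, homologyClass_straightPath, vector]
  · conv_lhs => rw [← α.arc_curve, absDet_arc]
    rw [straightCurve, homologyClass_straightPath, vector]

theorem exists_pair_completing {α β : Arc} (h : α.absDet β = 1) :
    ∃ σ τ : Arc, σ ≠ τ ∧
      (∀ ε : Arc, α.absDet ε = 1 ∧ β.absDet ε = 1 ↔ ε = σ ∨ ε = τ) ∧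
      ∀ ℓ : Arc, max (ℓ.absDet σ) (ℓ.absDet τ) = ℓ.absDet α + ℓ.absDet β := by
  have hadd : (det α.vector (α.vector + β.vector)).natAbs = 1 := by
    rwa [det_add_right, det_self, zero_add]
  have hsub : (det α.vector (α.vector - β.vector)).natAbs = 1 := by
    rwa [det_sub_right, det_self, zero_sub, Int.natAbs_neg]
  obtain ⟨σ, hσ, hασ⟩ := exists_vector (isCoprime_of_natAbs_det_eq_one hadd)
  obtain ⟨τ, hτ, hατ⟩ := exists_vector (isCoprime_of_natAbs_det_eq_one hsub)
  have hmax (ℓ : Arc) : max (ℓ.absDet σ) (ℓ.absDet τ) = ℓ.absDet α + ℓ.absDet β := by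
    rw [hασ, hατ, det_add_right, det_sub_right, absDet, absDet]
    omega
  refine ⟨σ, τ, ?_, fun ε ↦ ⟨fun ⟨hαε, hβε⟩ ↦ ?_, ?_⟩, hmax⟩
  · rintro rfl
    have := hmax σ
    rw [absDet_self, max_self, eq_comm, add_eq_zero, absDet_eq_zero_iff, absDet_eq_zero_iff] at this
    rw [← this.1, ← this.2, absDet_self] at h
    exact zero_ne_one h
  · rw [hσ, hτ]
    exact eq_or_eq_neg_of_natAbs_det_eq_one h hαε hβε
  · rintro (rfl | rfl)
    · refine ⟨(hασ α).trans hadd, ?_⟩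
      rw [hασ, det_add_right, det_self, add_zero]
      exact (β.absDet_comm α).trans h
    · refine ⟨(hατ α).trans hsub, ?_⟩
      rw [hατ, det_sub_right, det_self, sub_zero]
      exact (β.absDet_comm α).trans h

end Arc

theorem isTriangulation_iff {M : Fin 3 → Arc} :
    IsTriangulation M ↔ ∀ i j, i ≠ j → (M i).absDet (M j) = 1 := by
  refine ⟨fun h i j hij ↦ (Arc.compatible_iff (h.distinct.ne hij)).1 (h.compatible i j hij),
    fun h ↦ ?_⟩
  have hne : ∀ i j, i ≠ j → M i ≠ M j := fun i j hij hM ↦ by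
    simpa [hM, Arc.absDet_self] using h i j hij
  refine ⟨fun i j hM ↦ by_contra fun hij ↦ hne i j hij hM,
    fun i j hij ↦ (Arc.compatible_iff (hne i j hij)).2 (h i j hij), fun α hα ↦ ?_⟩
  by_contra! hαM
  have hαM' := fun i ↦ (Arc.compatible_iff (hαM i)).1 (hα i)
  exact Arc.not_pairwise_absDet_eq_one (hαM' 0) (hαM' 1) (hαM' 2) (h 0 1 (by decide))
    (h 0 2 (by decide)) (h 1 2 (by decide))

/-! ### Flips -/

theorem exists_ne_ne (k : Fin 3) : ∃ i j, i ≠ j ∧ i ≠ k ∧ j ≠ k := by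
  revert k
  decide

theorem isTriangulation_iff_of_ne {M : Fin 3 → Arc} {i j k : Fin 3} (hij : i ≠ j) (hik : i ≠ k)
    (hjk : j ≠ k) : IsTriangulation M ↔
      (M i).absDet (M j) = 1 ∧ (M i).absDet (M k) = 1 ∧ (M j).absDet (M k) = 1 := by
  rw [isTriangulation_iff]
  refine ⟨fun h ↦ ⟨h i j hij, h i k hik, h j k hjk⟩, fun ⟨h₁, h₂, h₃⟩ ↦ ?_⟩
  have hcover (l : Fin 3) : l = i ∨ l = j ∨ l = k := by omega
  intro l m hlm
  rcases hcover l with rfl | rfl | rfl <;> rcases hcover m with rfl | rfl | rfl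
  all_goals first
    | exact absurd rfl hlm
    | assumption
    | rw [Arc.absDet_comm]; assumption

theorem IsTriangulation.exists_exchange {M : Fin 3 → Arc} (hM : IsTriangulation M) {i j k : Fin 3}
    (hij : i ≠ j) (hik : i ≠ k) (hjk : j ≠ k) :
    ∃ τ ≠ M k,
      (∀ ε, (M i).absDet ε = 1 ∧ (M j).absDet ε = 1 ↔ ε = M k ∨ ε = τ) ∧
      ∀ ℓ : Arc, max (ℓ.absDet (M k)) (ℓ.absDet τ) = ℓ.absDet (M i) + ℓ.absDet (M j) := by
  obtain ⟨h, hk⟩ := (isTriangulation_iff_of_ne hij hik hjk).1 hM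
  obtain ⟨σ, τ, hστ, hiff, hmax⟩ := Arc.exists_pair_completing h
  rcases (hiff _).1 hk with hkσ | hkτ
  · exact ⟨τ, hkσ ▸ hστ.symm, hkσ ▸ hiff, hkσ ▸ hmax⟩
  · refine ⟨σ, hkτ ▸ hστ, fun ε ↦ ?_, fun ℓ ↦ ?_⟩
    · rw [hiff, hkτ, or_comm]
    · rw [← hmax, hkτ, max_comm]

theorem IsFlip.symm {k : Fin 3} {M M' : Fin 3 → Arc} (h : IsFlip k M M') : IsFlip k M' M :=
  ⟨h.target, h.source, fun j hj ↦ (h.fixed j hj).symm, h.exchanged.symm⟩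

theorem IsFlip.max_absDet {M M' : Fin 3 → Arc} {i j k : Fin 3} (h : IsFlip k M M')
    (hij : i ≠ j) (hik : i ≠ k) (hjk : j ≠ k) (ℓ : Arc) :
    max (ℓ.absDet (M k)) (ℓ.absDet (M' k)) = ℓ.absDet (M i) + ℓ.absDet (M j) := by
  obtain ⟨τ, -, hiff, hmax⟩ := h.source.exists_exchange hij hik hjk
  have htarget := ((isTriangulation_iff_of_ne hij hik hjk).1 h.target).2
  rw [h.fixed i hik, h.fixed j hjk] at htarget
  rw [((hiff _).1 htarget).resolve_left h.exchanged, hmax]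

theorem IsTriangulation.existsUnique_isFlip {M : Fin 3 → Arc} (hM : IsTriangulation M)
    (k : Fin 3) : ∃! M', IsFlip k M M' := by
  obtain ⟨i, j, hij, hik, hjk⟩ := exists_ne_ne k
  obtain ⟨τ, hτ, hiff, -⟩ := hM.exists_exchange hij hik hjk
  refine ⟨Function.update M k τ, ⟨hM, ?_, fun l hl ↦ Function.update_of_ne hl _ _, ?_⟩,
    fun M' h ↦ ?_⟩
  · rw [isTriangulation_iff_of_ne hij hik hjk, Function.update_self, Function.update_of_ne hik,
      Function.update_of_ne hjk]
    exact ⟨((isTriangulation_iff_of_ne hij hik hjk).1 hM).1, (hiff τ).2 (.inr rfl)⟩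
  · rwa [Function.update_self]
  · have htarget := ((isTriangulation_iff_of_ne hij hik hjk).1 h.target).2
    rw [h.fixed i hik, h.fixed j hjk] at htarget
    exact Function.eq_update_iff.2 ⟨((hiff _).1 htarget).resolve_left h.exchanged, h.fixed⟩

theorem existsUnique_isClusterPattern {L : Fin 3 → Arc} (hL : IsTriangulation L) :
    ∃! P, IsClusterPattern L P := by
  choose flip hflip hunique using fun (M : {M // IsTriangulation M}) k ↦ M.2.existsUnique_isFlip k
  let step (k : Fin 3) (M : {M // IsTriangulation M}) : {M // IsTriangulation M} :=
    ⟨flip M k, (hflip M k).target⟩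
  refine ⟨fun t ↦ (t.1.foldr step ⟨L, hL⟩).1, ⟨rfl, ?_⟩, fun P hP ↦ ?_⟩
  · rintro k ⟨w, hw⟩ ⟨w', hw'⟩ (rfl | rfl)
    · exact hflip _ k
    · exact (hflip _ k).symm
  · funext ⟨w, hw⟩
    induction w with
    | nil => exact hP.initial
    | cons k w ih =>
      refine hunique _ k _ ?_
      dsimp only
      rw [← ih hw.tail]
      exact hP.flip k ⟨w, hw.tail⟩ ⟨k :: w, hw⟩ (.inl rfl)

/-! ### Intersection vectors in the Calkin–Wilf tree -/

theorem eq_thirdLabel {a b c : Fin 3} (hca : c ≠ a) (hcb : c ≠ b) (hab : a ≠ b) :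
    c = thirdLabel a b := by
  revert a b c
  decide

namespace CWNode

/-- The vector with the entries `x`, `y` and `x + y` at the right label, the left label and the
third label of a node `x / y`. Diminished by one, these are the entries of the intersection vector
at the corresponding vertex. -/
def vector (n : CWNode) (i : Fin 3) : ℕ :=
  if i = n.rightLabel then n.x else if i = n.leftLabel then n.y else n.x + n.y

variable {n : CWNode}

theorem vector_rightLabel : n.vector n.rightLabel = n.x := if_pos rfl

theorem vector_leftLabel (h : n.leftLabel ≠ n.rightLabel) : n.vector n.leftLabel = n.y := by
  rw [vector, if_neg h, if_pos rfl]

theorem vector_thirdLabel (h : n.leftLabel ≠ n.rightLabel) :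
    n.vector (thirdLabel n.leftLabel n.rightLabel) = n.x + n.y := by
  rw [vector, if_neg (thirdLabel_ne _ _ h).2, if_neg (thirdLabel_ne _ _ h).1]

theorem thirdLabel_child (s : Side) :
    thirdLabel (n.child s).leftLabel (n.child s).rightLabel = n.label s := by
  cases s <;> simp [thirdLabel, child, label]

theorem label_ne_thirdLabel (h : n.leftLabel ≠ n.rightLabel) (s : Side) :
    n.label s ≠ thirdLabel n.leftLabel n.rightLabel := by
  cases s
  exacts [(thirdLabel_ne _ _ h).1.symm, (thirdLabel_ne _ _ h).2.symm]

theorem label_injective (h : n.leftLabel ≠ n.rightLabel) : Function.Injective n.label := by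
  rintro (_ | _) (_ | _) hs
  exacts [rfl, absurd hs h, absurd hs.symm h, rfl]

theorem exists_label_eq (h : n.leftLabel ≠ n.rightLabel) {k : Fin 3}
    (hk : k ≠ thirdLabel n.leftLabel n.rightLabel) : ∃ s, k = n.label s := by
  by_contra! hs
  exact hk (eq_thirdLabel (hs .left) (hs .right) h)

theorem leftLabel_ne_rightLabel_child (h : n.leftLabel ≠ n.rightLabel) (s : Side) :
    (n.child s).leftLabel ≠ (n.child s).rightLabel := by
  cases s
  exacts [(thirdLabel_ne _ _ h).2, (thirdLabel_ne _ _ h).1.symm]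

theorem eq_or_eq_or_eq_thirdLabel (h : n.leftLabel ≠ n.rightLabel) (i : Fin 3) :
    i = n.leftLabel ∨ i = n.rightLabel ∨ i = thirdLabel n.leftLabel n.rightLabel := by
  by_contra! hi
  exact hi.2.2 (eq_thirdLabel hi.1 hi.2.1 h)

theorem vector_child_of_ne (h : n.leftLabel ≠ n.rightLabel) {s : Side} {i : Fin 3}
    (hi : i ≠ n.label s) : (n.child s).vector i = n.vector i := by
  have hi' := eq_or_eq_or_eq_thirdLabel h i
  cases s <;> grind [vector, child, label, thirdLabel_ne]

theorem vector_child_label (h : n.leftLabel ≠ n.rightLabel) {s : Side} {i j : Fin 3} (hij : i ≠ j)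
    (hi : i ≠ n.label s) (hj : j ≠ n.label s) :
    (n.child s).vector (n.label s) = n.vector i + n.vector j := by
  have hi' := eq_or_eq_or_eq_thirdLabel h i
  have hj' := eq_or_eq_or_eq_thirdLabel h j
  cases s <;> grind [vector, child, label, thirdLabel_ne]

theorem vector_label (h : n.leftLabel ≠ n.rightLabel) {s : Side} {i j : Fin 3} (hij : i ≠ j)
    (hi : i ≠ n.label s) (hj : j ≠ n.label s) :
    n.vector (n.label s) = (n.vector i - n.vector j : ℤ).natAbs := by
  have hi' := eq_or_eq_or_eq_thirdLabel h i
  have hj' := eq_or_eq_or_eq_thirdLabel h j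
  cases s <;> grind [vector, label, thirdLabel_ne]

end CWNode

theorem leftLabel_ne_rightLabel (p : List Side) : (cwNode p).leftLabel ≠ (cwNode p).rightLabel := by
  induction p with
  | nil => exact one_ne_zero
  | cons s p ih => exact CWNode.leftLabel_ne_rightLabel_child ih s

theorem x_pos_and_y_pos (p : List Side) : 0 < (cwNode p).x ∧ 0 < (cwNode p).y := by
  induction p with
  | nil => exact ⟨one_pos, one_pos⟩
  | cons s p ih =>
    cases s
    exacts [⟨ih.1, Nat.add_pos_left ih.1 _⟩, ⟨Nat.add_pos_left ih.1 _, ih.2⟩]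

theorem thirdLabel_cwNode_cons (s : Side) (p : List Side) :
    thirdLabel (cwNode (s :: p)).leftLabel (cwNode (s :: p)).rightLabel = (cwNode p).label s :=
  CWNode.thirdLabel_child s

theorem vector_cwNode_pos (p : List Side) (i : Fin 3) : 0 < (cwNode p).vector i := by
  obtain ⟨hx, hy⟩ := x_pos_and_y_pos p
  rw [CWNode.vector]
  split_ifs
  exacts [hx, hy, Nat.add_pos_left hx _]

theorem vector_lt_vector_label {s : Side} {p : List Side} {i : Fin 3}
    (hi : i ≠ (cwNode p).label s) :
    (cwNode (s :: p)).vector i < (cwNode (s :: p)).vector ((cwNode p).label s) := by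
  obtain ⟨hx, hy⟩ := x_pos_and_y_pos (s :: p)
  have h := leftLabel_ne_rightLabel (s :: p)
  rw [← thirdLabel_cwNode_cons] at hi ⊢
  rw [CWNode.vector_thirdLabel h]
  rcases CWNode.eq_or_eq_or_eq_thirdLabel h i with rfl | rfl | rfl
  · rw [CWNode.vector_leftLabel h]
    omega
  · rw [CWNode.vector_rightLabel]
    omega
  · exact absurd rfl hi

theorem vector_cons_ne_vector_nil (s : Side) (p : List Side) :
    (cwNode (s :: p)).vector ≠ (cwNode []).vector := by
  intro h
  obtain ⟨hx, hy⟩ := x_pos_and_y_pos p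
  have hlt : 2 < (cwNode (s :: p)).x + (cwNode (s :: p)).y := by
    cases s <;> simp only [cwNode, CWNode.child] <;> omega
  have hle : ∀ i, (cwNode []).vector i ≤ 2 := by decide
  rw [← CWNode.vector_thirdLabel (leftLabel_ne_rightLabel _), h] at hlt
  exact hlt.not_ge (hle _)

theorem vector_cwNode_injective : Function.Injective fun p ↦ (cwNode p).vector := by
  intro p
  induction p with
  | nil =>
    rintro (_ | ⟨s, q⟩) hpq
    exacts [rfl, absurd hpq.symm (vector_cons_ne_vector_nil s q)]
  | cons s p ih =>
    rintro (_ | ⟨s', q⟩) (hpq : (cwNode _).vector = (cwNode _).vector)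
    · exact absurd hpq (vector_cons_ne_vector_nil s p)
    have hlabel : (cwNode p).label s = (cwNode q).label s' := by
      by_contra h
      have hlt := vector_lt_vector_label (Ne.symm h)
      rw [hpq] at hlt
      exact hlt.not_gt (vector_lt_vector_label h)
    have hne {i} (hi : i ≠ (cwNode p).label s) : (cwNode p).vector i = (cwNode q).vector i := by
      rw [← CWNode.vector_child_of_ne (leftLabel_ne_rightLabel p) hi,
        ← CWNode.vector_child_of_ne (leftLabel_ne_rightLabel q) (hlabel ▸ hi)]
      exact congrFun hpq i
    have heq : (cwNode p).vector ((cwNode p).label s) = (cwNode q).vector ((cwNode p).label s) := by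
      obtain ⟨i, j, hij, hi, hj⟩ := exists_ne_ne ((cwNode p).label s)
      rw [CWNode.vector_label (leftLabel_ne_rightLabel p) hij hi hj, hne hi, hne hj]
      rw [hlabel] at hi hj ⊢
      rw [CWNode.vector_label (leftLabel_ne_rightLabel q) hij hi hj]
    obtain rfl : p = q := ih <| funext fun i ↦ (eq_or_ne i _).elim (fun hi ↦ hi ▸ heq) hne
    rw [CWNode.label_injective (leftLabel_ne_rightLabel p) hlabel]

/-- The labels of the edges on the way from `t₀` through `t₁` along a path of the Calkin–Wilf
tree, the last one at the head. -/
def labelPath : List Side → List (Fin 3)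
  | [] => [2]
  | s :: p => (cwNode p).label s :: labelPath p

theorem exists_labelPath_eq_thirdLabel_cons (p : List Side) :
    ∃ w, labelPath p = thirdLabel (cwNode p).leftLabel (cwNode p).rightLabel :: w := by
  cases p with
  | nil => exact ⟨[], rfl⟩
  | cons s p => exact ⟨labelPath p, by rw [thirdLabel_cwNode_cons, labelPath]⟩

theorem isChain_cons_labelPath_iff {k : Fin 3} {p : List Side} (h : (labelPath p).IsChain (· ≠ ·)) :
    (k :: labelPath p).IsChain (· ≠ ·) ↔ ∃ s, k = (cwNode p).label s := by
  obtain ⟨w, hw⟩ := exists_labelPath_eq_thirdLabel_cons p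
  rw [hw] at h ⊢
  rw [List.isChain_cons_cons, and_iff_left h]
  refine ⟨CWNode.exists_label_eq (leftLabel_ne_rightLabel p), ?_⟩
  rintro ⟨s, rfl⟩
  exact CWNode.label_ne_thirdLabel (leftLabel_ne_rightLabel p) s

theorem isChain_labelPath (p : List Side) : (labelPath p).IsChain (· ≠ ·) := by
  induction p with
  | nil => exact List.isChain_singleton 2
  | cons s p ih => exact (isChain_cons_labelPath_iff ih).2 ⟨s, rfl⟩

theorem labelPath_ne_nil (p : List Side) : labelPath p ≠ [] := by
  cases p <;> exact List.cons_ne_nil _ _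

theorem getLast?_labelPath (p : List Side) : (labelPath p).getLast? = some 2 := by
  induction p with
  | nil => rfl
  | cons s p ih => rw [labelPath, List.getLast?_cons, ih, Option.getD_some]

theorem labelPath_injective : Function.Injective labelPath := by
  intro p
  induction p with
  | nil =>
    rintro (_ | ⟨s, q⟩) h
    exacts [rfl, absurd (List.cons.inj h).2.symm (labelPath_ne_nil q)]
  | cons s p ih =>
    rintro (_ | ⟨s', q⟩) h
    · exact absurd (List.cons.inj h).2 (labelPath_ne_nil p)
    · obtain ⟨hlabel, htail⟩ := List.cons.inj h
      obtain rfl := ih htail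
      rw [CWNode.label_injective (leftLabel_ne_rightLabel p) hlabel]

theorem exists_labelPath_eq {w : List (Fin 3)} (hw : w.IsChain (· ≠ ·))
    (hlast : w.getLast? = some 2) : ∃ p, labelPath p = w := by
  induction w with
  | nil => cases hlast
  | cons k w ih =>
    rcases w with _ | ⟨l, w⟩
    · exact ⟨[], by simpa [labelPath, eq_comm] using hlast⟩
    · obtain ⟨p, hp⟩ := ih hw.tail (by simpa using hlast)
      rw [← hp] at hw ⊢
      obtain ⟨s, rfl⟩ := (isChain_cons_labelPath_iff (isChain_labelPath p)).1 hw
      exact ⟨s :: p, rfl⟩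

theorem labelPath_eq_cons_iff {k : Fin 3} {p q : List Side} :
    labelPath q = k :: labelPath p ↔ ∃ s, q = s :: p ∧ k = (cwNode p).label s := by
  constructor
  · intro h
    cases q with
    | nil => exact absurd (List.cons.inj h).2.symm (labelPath_ne_nil p)
    | cons s q =>
      obtain ⟨hlabel, htail⟩ := List.cons.inj h
      obtain rfl := labelPath_injective htail
      exact ⟨s, rfl, hlabel.symm⟩
  · rintro ⟨s, rfl, rfl⟩
    rfl

/-- The vertex of the subtree behind `t₁` that corresponds to a vertex of the Calkin–Wilf tree. -/
def vertex (p : List Side) : T3' := ⟨⟨labelPath p, isChain_labelPath p⟩, getLast?_labelPath p⟩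

theorem vertex_bijective : Function.Bijective vertex := by
  refine ⟨fun p q h ↦ labelPath_injective (congrArg (·.1.1) h), fun ⟨⟨w, hw⟩, hlast⟩ ↦ ?_⟩
  obtain ⟨p, rfl⟩ := exists_labelPath_eq hw hlast
  exact ⟨p, rfl⟩

theorem edge_vertex_iff {k : Fin 3} {p q : List Side} :
    T3'.Edge k (vertex p) (vertex q) ↔ calkinWilfTree.Edge k p q :=
  (or_congr labelPath_eq_cons_iff labelPath_eq_cons_iff).trans exists_or.symm

theorem child_vertex_iff {k : Fin 3} {p : List Side} {t : T3'} :
    T3'.Child k (vertex p) t ↔ ∃ s, k = (cwNode p).label s ∧ t = vertex (s :: p) := by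
  constructor
  · obtain ⟨q, rfl⟩ := vertex_bijective.2 t
    rintro ⟨h | h, hlt⟩
    · obtain ⟨s, rfl, hk⟩ := labelPath_eq_cons_iff.1 h
      exact ⟨s, hk, rfl⟩
    · rw [h] at hlt
      exact absurd hlt (by simp)
  · rintro ⟨s, rfl, rfl⟩
    exact ⟨.inl rfl, Nat.lt_succ_self _⟩

theorem LabelledTree.Same.symm {X : Type} {T U : LabelledTree X} : T.Same U → U.Same T :=
  fun ⟨φ, hroot, hedge, hval⟩ ↦ ⟨φ.symm, φ.symm_apply_eq.2 hroot.symm,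
    fun k v w ↦ by rw [hedge, φ.apply_symm_apply, φ.apply_symm_apply],
    fun v ↦ by rw [hval, φ.apply_symm_apply]⟩

theorem same_calkinWilfTree {X : Type} {val : T3' → X} {f : ℕ × ℕ → X}
    (hval : ∀ p, val (vertex p) = f (calkinWilfTree.val p)) :
    LabelledTree.Same ⟨T3', T3'.t1, T3'.Edge, val⟩ (calkinWilfTree.replace f) :=
  LabelledTree.Same.symm ⟨Equiv.ofBijective vertex vertex_bijective, rfl,
    fun _ _ _ ↦ edge_vertex_iff.symm, fun p ↦ (hval p).symm⟩

section RatioMap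

variable {d : T3' → Fin 3 → ℕ}

theorem IsRatioMap.apply_vertex {num den : T3' → Fin 3} {h : Set.range d → ℚ}
    (hh : IsRatioMap d num den h) (hd : ∀ p i, d (vertex p) i + 1 = (cwNode p).vector i)
    (p : List Side) :
    num (vertex p) = (cwNode p).rightLabel ∧ den (vertex p) = (cwNode p).leftLabel ∧
      h ⟨d (vertex p), vertex p, rfl⟩ = fractionValue (calkinWilfTree.val p) := by
  have hdQ (p i) : (d (vertex p) i + 1 : ℚ) = (cwNode p).vector i := by exact_mod_cast hd p i
  induction p with
  | nil =>
    refine ⟨hh.num_root, hh.den_root, hh.root.trans ?_⟩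
    rw [show T3'.t1 = vertex [] from rfl, hdQ, hdQ]
    rfl
  | cons s p ih =>
    obtain ⟨hnum, hden, -⟩ := ih
    have hlabel := leftLabel_ne_rightLabel p
    obtain ⟨hthird_left, hthird_right⟩ := thirdLabel_ne _ _ hlabel
    have hchild : T3'.Child _ (vertex p) (vertex (s :: p)) := child_vertex_iff.2 ⟨s, rfl, rfl⟩
    cases s with
    | left =>
      obtain ⟨hnum', hden', hval⟩ := hh.step_den _ _ _ _ hchild
        (hthird_right.trans_eq hnum.symm) (hthird_left.trans_eq hden.symm) hden.symm
      refine ⟨hnum'.trans hnum, hden', hval.trans ?_⟩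
      rw [hnum, hdQ, hdQ, CWNode.vector_rightLabel, CWNode.vector_thirdLabel hlabel]
      rfl
    | right =>
      obtain ⟨hnum', hden', hval⟩ := hh.step_num _ _ _ _ hchild
        (hthird_right.trans_eq hnum.symm) (hthird_left.trans_eq hden.symm) hnum.symm
      refine ⟨hnum', hden'.trans hden, hval.trans ?_⟩
      rw [hden, hdQ, hdQ, CWNode.vector_leftLabel hlabel, CWNode.vector_thirdLabel hlabel]
      rfl

theorem isRatioMap_of_apply_vertex {num den : T3' → Fin 3} {h : Set.range d → ℚ}
    (hd : ∀ p i, d (vertex p) i + 1 = (cwNode p).vector i)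
    (hnum : ∀ p, num (vertex p) = (cwNode p).rightLabel)
    (hden : ∀ p, den (vertex p) = (cwNode p).leftLabel)
    (hh : ∀ p, h ⟨d (vertex p), vertex p, rfl⟩ = fractionValue (calkinWilfTree.val p)) :
    IsRatioMap d num den h := by
  have hdQ (p i) : (d (vertex p) i + 1 : ℚ) = (cwNode p).vector i := by exact_mod_cast hd p i
  refine ⟨hnum [], hden [], (hh []).trans ?_, ?_, ?_⟩
  · rw [show T3'.t1 = vertex [] from rfl, hdQ, hdQ]
    rfl
  all_goals
    intro k c t t' hchild hc_num hc_den hk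
    obtain ⟨p, rfl⟩ := vertex_bijective.2 t
    obtain ⟨s, rfl, rfl⟩ := child_vertex_iff.1 hchild
    have hlabel := leftLabel_ne_rightLabel p
    rw [hnum] at hc_num
    rw [hden] at hc_den
    obtain rfl := eq_thirdLabel hc_den hc_num hlabel
  · obtain rfl : s = .right := CWNode.label_injective hlabel (hk.trans (hnum p))
    refine ⟨hnum _, (hden _).trans (hden p).symm, (hh _).trans ?_⟩
    rw [hden, hdQ, hdQ, CWNode.vector_thirdLabel hlabel, CWNode.vector_leftLabel hlabel]
    rfl
  · obtain rfl : s = .left := CWNode.label_injective hlabel (hk.trans (hden p))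
    refine ⟨(hnum _).trans (hnum p).symm, hden _, (hh _).trans ?_⟩
    rw [hnum, hdQ, hdQ, CWNode.vector_thirdLabel hlabel, CWNode.vector_rightLabel]
    rfl

theorem existsUnique_isRatioMap (hd : ∀ p i, d (vertex p) i + 1 = (cwNode p).vector i) :
    ∃! h, ∃ num den, IsRatioMap d num den h := by
  let φ := Equiv.ofBijective vertex vertex_bijective
  let ψ : List Side ≃ Set.range d := Equiv.ofBijective (fun p ↦ ⟨d (vertex p), vertex p, rfl⟩) <| by
    refine ⟨fun p q hpq ↦ vector_cwNode_injective (funext fun i ↦ ?_), fun ⟨_, t, ht⟩ ↦ ?_⟩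
    · dsimp only
      rw [← hd, ← hd]
      exact congrArg (fun v : Set.range d ↦ v.1 i + 1) hpq
    · obtain ⟨p, rfl⟩ := vertex_bijective.2 t
      exact ⟨p, Subtype.ext ht⟩
  have hφ (p) : φ.symm (vertex p) = p := φ.symm_apply_apply p
  refine ⟨fun v ↦ fractionValue (calkinWilfTree.val (ψ.symm v)),
    ⟨fun t ↦ (cwNode (φ.symm t)).rightLabel, fun t ↦ (cwNode (φ.symm t)).leftLabel,
      isRatioMap_of_apply_vertex hd (fun p ↦ by rw [hφ]) (fun p ↦ by rw [hφ]) fun p ↦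
        congrArg (fractionValue ∘ calkinWilfTree.val) (ψ.symm_apply_apply p)⟩, ?_⟩
  rintro h ⟨num, den, hh⟩
  funext v
  obtain ⟨p, rfl⟩ := ψ.surjective v
  rw [ψ.symm_apply_apply]
  exact (hh.apply_vertex hd p).2.2

end RatioMap

section Pattern

variable {L : Fin 3 → Arc} {P : T3 → Fin 3 → Arc}

theorem IsClusterPattern.absDet_vertex_nil (hP : IsClusterPattern L P) :
    (fun i ↦ (L 2).absDet (P (vertex []).1 i)) = (cwNode []).vector := by
  have hflip : IsFlip 2 L (P (vertex []).1) := hP.initial ▸ hP.flip 2 T3.t0 _ (.inl rfl)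
  have hL := isTriangulation_iff.1 hflip.source
  have hne (i : Fin 3) (hi : i ≠ 2) : (L 2).absDet (P (vertex []).1 i) = 1 := by
    rw [hflip.fixed i hi, hL 2 i hi.symm]
  have hmax := hflip.max_absDet (i := 0) (j := 1) (by decide) (by decide) (by decide) (L 2)
  rw [Arc.absDet_self, Nat.zero_max, hL 2 0 (by decide), hL 2 1 (by decide)] at hmax
  ext i
  fin_cases i
  exacts [hne 0 (by decide), hne 1 (by decide), hmax]

theorem IsClusterPattern.absDet_vertex (hP : IsClusterPattern L P) (p : List Side) (i : Fin 3) :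
    (L 2).absDet (P (vertex p).1 i) = (cwNode p).vector i := by
  induction p generalizing i with
  | nil => exact congrFun hP.absDet_vertex_nil i
  | cons s p ih =>
    have hlabel := leftLabel_ne_rightLabel p
    have hflip : IsFlip ((cwNode p).label s) (P (vertex p).1) (P (vertex (s :: p)).1) :=
      hP.flip _ _ _ (.inl rfl)
    rcases eq_or_ne i ((cwNode p).label s) with rfl | hi
    · obtain ⟨i, j, hij, hi, hj⟩ := exists_ne_ne ((cwNode p).label s)
      have hmax := hflip.max_absDet hij hi hj (L 2)
      rw [ih, ih, ih, CWNode.vector_label hlabel hij hi hj] at hmax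
      have hi_pos := vector_cwNode_pos p i
      have hj_pos := vector_cwNode_pos p j
      rw [cwNode, CWNode.vector_child_label hlabel hij hi hj]
      omega
    · rw [hflip.fixed i hi, ih, cwNode, CWNode.vector_child_of_ne hlabel hi]

theorem IsClusterPattern.initialVector_vertex_add_one (hP : IsClusterPattern L P) (p : List Side)
    (i : Fin 3) : initialVector P (L 2) (vertex p) i + 1 = (cwNode p).vector i := by
  rw [initialVector, intersectionVector, Arc.intersectionNumber_eq, hP.absDet_vertex,
    Nat.sub_add_cancel (vector_cwNode_pos p i)]

end Pattern

end PuncturedTorus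

theorem theorem4p3 (L : Fin 3 → PuncturedTorus.Arc) (hL : PuncturedTorus.IsTriangulation L) :
    (∃! P : PuncturedTorus.T3 → Fin 3 → PuncturedTorus.Arc,
      PuncturedTorus.IsClusterPattern L P) ∧
    ∀ P : PuncturedTorus.T3 → Fin 3 → PuncturedTorus.Arc, PuncturedTorus.IsClusterPattern L P →
      (∃! h : Set.range (PuncturedTorus.initialVector P (L 2)) → ℚ,
        ∃ num den : PuncturedTorus.T3' → Fin 3,
          PuncturedTorus.IsRatioMap (PuncturedTorus.initialVector P (L 2)) num den h) ∧
      ∀ (h : Set.range (PuncturedTorus.initialVector P (L 2)) → ℚ)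
        (num den : PuncturedTorus.T3' → Fin 3),
        PuncturedTorus.IsRatioMap (PuncturedTorus.initialVector P (L 2)) num den h →
          ((PuncturedTorus.initialIntersectionVectorTree P (L 2)).replace h).Same
            (PuncturedTorus.calkinWilfTree.replace PuncturedTorus.fractionValue) ∧
          (PuncturedTorus.writtenFractionTree (PuncturedTorus.initialVector P (L 2)) num den).Same
            PuncturedTorus.calkinWilfTree := by
  open PuncturedTorus in
  refine ⟨existsUnique_isClusterPattern hL, fun P hP ↦ ?_⟩
  have hvector := hP.initialVector_vertex_add_one
  refine ⟨existsUnique_isRatioMap hvector, fun h num den hh ↦ ⟨?_, ?_⟩⟩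
  · exact same_calkinWilfTree fun p ↦ (hh.apply_vertex hvector p).2.2
  · refine same_calkinWilfTree (f := id) fun p ↦ ?_
    obtain ⟨hnum, hden, -⟩ := hh.apply_vertex hvector p
    rw [hnum, hden, hvector, hvector, CWNode.vector_rightLabel,
      CWNode.vector_leftLabel (leftLabel_ne_rightLabel p)]
    rfl
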